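/- Let $n\ge 0$, let $X\subset\mathbb{R}^n$ be compact, and let $f:X\to\mathbb{R}$ be Lebesgue-integrable on $X$ and positive-homogeneous, i.e. $f(\lambda x)=\lambda f(x)$ for all $\lambda>0$ and all $x\in X$ with $\lambda x\in X$. A bias-free ReLU network (a HomoMLP with ReLU activation) with $n$ inputs and one output is a function of the form $$F(x)=W^K\,\mathrm{ReLU}\bigl(W^{K-1}\,\mathrm{ReLU}(\cdots\mathrm{ReLU}(W^1x)\cdots)\bigr),\qquad K\ge 1,$$ where $W^1,\dots,W^K$ are real matrices of compatible sizes and $\mathrm{ReLU}(t)=\max(t,0)$ acts coordinatewise; its width is the largest number of units in any of its layers, the input and output layers included. Then for every $\varepsilon>0$ there is a bias-free ReLU network of finite depth $K$ and of width at most $2(n+4)$, representing a function $F$, such that $|f-F|$ is integrable on $X$ and $$\int_X |f(x)-F(x)|\,dx<\varepsilon .$$ -/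

import Mathlib

open MeasureTheory

/-- `f` is positive-homogeneous as a function on `X`: `f (l • x) = l * f x` for every `l > 0`,
whenever both `x` and `l • x` belong to the domain `X`. -/
def PosHomogeneousOn {E : Type*} [AddCommGroup E] [Module ℝ E] (f : E → ℝ) (X : Set E) : Prop :=
  ∀ l : ℝ, 0 < l → ∀ x ∈ X, l • x ∈ X → f (l • x) = l * f x

/-- The rectified linear unit. -/
noncomputable def relu (t : ℝ) : ℝ := max t 0

/-- The (finite) list of weight matrices of a multilayer perceptron without biases, with `n` inputs
and `m` outputs. `output W` is the last layer; `hidden W rest` is a layer of `k` hidden units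
followed by the layers `rest`. -/
inductive WeightStack : ℕ → ℕ → Type
  | output {n m : ℕ} (W : Matrix (Fin m) (Fin n) ℝ) : WeightStack n m
  | hidden {n k m : ℕ} (W : Matrix (Fin k) (Fin n) ℝ) (rest : WeightStack k m) : WeightStack n m

/-- The largest number of units in a layer; the input layer, all the hidden layers and the output
layer are counted. -/
def WeightStack.width : {n m : ℕ} → WeightStack n m → ℕ
  | n, m, .output _ => max n m
  | n, _, .hidden _ rest => max n rest.width

/-- The function `x ↦ W^K σ (W^(K-1) σ (⋯ σ (W^1 x)))`, where the activation `σ` acts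
coordinatewise after every layer but the last one. -/
def WeightStack.eval (σ : ℝ → ℝ) : {n m : ℕ} → WeightStack n m → (Fin n → ℝ) → (Fin m → ℝ)
  | _, _, .output W, x => W.mulVec x
  | _, _, .hidden W rest, x => rest.eval σ (fun i => σ (W.mulVec x i))

/-- A HomoMLP: a multilayer perceptron without biases whose activation function is
positive-homogeneous. -/
structure HomoMLP (n m : ℕ) where
  /-- the activation function -/
  act : ℝ → ℝ
  /-- the activation function is positive-homogeneous -/
  act_homogeneous : PosHomogeneousOn act Set.univ
  /-- the weight matrices -/
  weights : WeightStack n m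

/-- The width of a HomoMLP. -/
def HomoMLP.width {n m : ℕ} (A : HomoMLP n m) : ℕ := A.weights.width

/-- The real-valued function represented by a HomoMLP with one output. -/
def HomoMLP.toFun {n : ℕ} (A : HomoMLP n 1) (x : Fin n → ℝ) : ℝ := A.weights.eval A.act x 0

/-! Averaging along rays replaces `f`, up to a null set, by a measurable homogeneous `G` on the
whole space (`PosHomogeneousOn.exists_measurable_ae_eq`). Such a function is determined by its
values on the unit sphere, so L¹ approximation there by a continuous `φ` gives L¹ approximation of
`f` by `‖x‖ * φ (‖x‖⁻¹ • x)`. By the lattice form of Stone–Weierstrass, `φ` is a uniform limit on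
the sphere of maxima of minima of linear forms. A narrow network evaluates these serially with `n +
3` signed registers: the input, a running maximum, a running minimum and a scratch cell. Each
register costs two ReLU units, hence width at most `2 * (n + 4)`. Homogeneity carries the estimate
from the sphere to `X`. -/

theorem relu_sub_relu_neg (t : ℝ) : relu t - relu (-t) = t := by
  unfold relu
  rcases le_total t 0 with h | h <;> simp [h]

theorem relu_mul_of_nonneg {c : ℝ} (hc : 0 ≤ c) (t : ℝ) : relu (c * t) = c * relu t := by
  unfold relu
  rw [mul_max_of_nonneg _ _ hc, mul_zero]

theorem continuous_relu : Continuous relu := continuous_id.max continuous_const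

theorem min_eq_sub_relu (a b : ℝ) : min a b = a - relu (a - b) := by
  unfold relu
  rcases le_total a b with h | h <;> simp [h]

theorem max_eq_add_relu (a b : ℝ) : max a b = a + relu (b - a) := by
  unfold relu
  rcases le_total a b with h | h <;> simp [h]

namespace WeightStack

theorem eval_relu_smul {n m : ℕ} (S : WeightStack n m) {c : ℝ} (hc : 0 ≤ c) (x : Fin n → ℝ) :
    S.eval relu (c • x) = c • S.eval relu x := by
  induction S with
  | output W => simp [eval, Matrix.mulVec_smul]
  | hidden W rest ih =>
    simp only [eval, Matrix.mulVec_smul, Pi.smul_apply, smul_eq_mul, relu_mul_of_nonneg hc]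
    exact ih _

theorem continuous_eval_relu {n m : ℕ} (S : WeightStack n m) : Continuous (S.eval relu) := by
  induction S with
  | output W =>
    simp only [eval]
    fun_prop
  | hidden W rest ih =>
    simp only [eval]
    refine ih.comp (continuous_pi fun i => continuous_relu.comp ?_)
    fun_prop

end WeightStack

/-! ### Serial computation with signed registers -/

section Registers

variable {ι : Type*} [Fintype ι]

/-- The values of `card (ι ⊕ ι)` rectified units that store the vector `v`: the positive parts of
its coordinates followed by the negative parts. -/
noncomputable def signedEncoding (v : ι → ℝ) : Fin (Fintype.card (ι ⊕ ι)) → ℝ :=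
  fun k => Sum.elim (fun i => relu (v i)) (fun i => relu (-v i)) ((Fintype.equivFin (ι ⊕ ι)).symm k)

/-- A function of a vector of registers that a bias-free ReLU network with at most `card (ι ⊕ ι)`
units per layer computes from the signed encoding of the registers. -/
def ComputableFromRegisters (G : (ι → ℝ) → ℝ) : Prop :=
  ∃ S : WeightStack (Fintype.card (ι ⊕ ι)) 1,
    S.width ≤ max (Fintype.card (ι ⊕ ι)) 1 ∧ ∀ v, S.eval relu (signedEncoding v) 0 = G v

/-- A register transformation that can be performed by some layers of a bias-free ReLU network. -/
def IsRegisterProgram (T : (ι → ℝ) → (ι → ℝ)) : Prop :=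
  ∀ G : (ι → ℝ) → ℝ, ComputableFromRegisters G → ComputableFromRegisters (G ∘ T)

theorem IsRegisterProgram.comp {T U : (ι → ℝ) → (ι → ℝ)} (hT : IsRegisterProgram T)
    (hU : IsRegisterProgram U) : IsRegisterProgram (T ∘ U) :=
  fun G hG => hU _ (hT G hG)

/-- The weight matrix with `W (signedEncoding v) = (A v⁺ + B v⁻, -(A v⁺ + B v⁻))`. -/
noncomputable def signedMatrix (A B : Matrix ι ι ℝ) :
    Matrix (Fin (Fintype.card (ι ⊕ ι))) (Fin (Fintype.card (ι ⊕ ι))) ℝ :=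
  Matrix.reindex (Fintype.equivFin (ι ⊕ ι)) (Fintype.equivFin (ι ⊕ ι))
    (Matrix.fromBlocks A B (-A) (-B))

theorem relu_signedMatrix_mulVec (A B : Matrix ι ι ℝ) (v : ι → ℝ) :
    (fun k => relu ((signedMatrix A B).mulVec (signedEncoding v) k)) =
      signedEncoding (fun i => ∑ j, (A i j * relu (v j) + B i j * relu (-v j))) := by
  funext k
  obtain ⟨s, rfl⟩ := (Fintype.equivFin (ι ⊕ ι)).surjective k
  have key : (signedMatrix A B).mulVec (signedEncoding v) (Fintype.equivFin (ι ⊕ ι) s) =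
      ∑ r, Matrix.fromBlocks A B (-A) (-B) s r *
        Sum.elim (fun i => relu (v i)) (fun i => relu (-v i)) r := by
    simp only [Matrix.mulVec, dotProduct, signedMatrix, signedEncoding, Matrix.reindex_apply,
      Matrix.submatrix_apply, Equiv.symm_apply_apply]
    exact Equiv.sum_comp (Fintype.equivFin (ι ⊕ ι)).symm (fun r =>
      Matrix.fromBlocks A B (-A) (-B) s r *
        Sum.elim (fun i => relu (v i)) (fun i => relu (-v i)) r)
  rw [key]
  rcases s with i | i <;>
    simp [signedEncoding, Fintype.sum_sum_type, Finset.sum_add_distrib, add_comm]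

theorem isRegisterProgram_matrix (A B : Matrix ι ι ℝ) :
    IsRegisterProgram fun v i => ∑ j, (A i j * relu (v j) + B i j * relu (-v j)) := by
  rintro G ⟨S, hS, hG⟩
  refine ⟨.hidden (signedMatrix A B) S, ?_, fun v => ?_⟩
  · exact max_le (le_max_left _ _) hS
  · simp only [WeightStack.eval, relu_signedMatrix_mulVec, hG, Function.comp]

/-- Taking `B = -A` recombines the two parts of each register, since `relu t - relu (-t) = t`. -/
theorem isRegisterProgram_linear [DecidableEq ι] (L : (ι → ℝ) →ₗ[ℝ] (ι → ℝ)) :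
    IsRegisterProgram L := by
  convert isRegisterProgram_matrix (LinearMap.toMatrix' L) (-LinearMap.toMatrix' L) using 1
  funext v i
  conv_lhs => rw [← Matrix.toLin'_toMatrix' L, Matrix.toLin'_apply]
  refine Finset.sum_congr rfl fun j _ => ?_
  rw [Matrix.neg_apply, neg_mul, ← sub_eq_add_neg, ← mul_sub, relu_sub_relu_neg]

theorem isRegisterProgram_update_linear [DecidableEq ι] (i : ι) (l : (ι → ℝ) →ₗ[ℝ] ℝ) :
    IsRegisterProgram fun v => Function.update v i (l v) := by
  convert isRegisterProgram_linear
    (LinearMap.pi fun j => if j = i then l else LinearMap.proj j) using 1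
  funext v j
  by_cases h : j = i
  · subst h; simp
  · simp [h]

theorem isRegisterProgram_update_relu [DecidableEq ι] (i : ι) :
    IsRegisterProgram fun v => Function.update v i (relu (v i)) := by
  -- A zero weight on the negative part rectifies register `i`; weight `-1` restores every other
  -- register.
  convert isRegisterProgram_matrix (1 : Matrix ι ι ℝ)
    (Matrix.diagonal fun j => if j = i then 0 else -1) using 1
  funext v j
  simp only [Matrix.one_apply, Matrix.diagonal_apply, ite_mul, one_mul, zero_mul,
    Finset.sum_add_distrib, Finset.sum_ite_eq, Finset.mem_univ, if_true]
  by_cases h : j = i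
  · subst h; simp
  · simp only [Function.update_of_ne h, if_neg h]
    linarith [relu_sub_relu_neg (v j)]

/-- A multiple of the rectification of a linear form can be added to register `i`, at the cost of
overwriting the scratch register `d`. -/
theorem isRegisterProgram_add_relu [DecidableEq ι] {i d : ι} (hid : i ≠ d) (c : ℝ)
    (l : (ι → ℝ) →ₗ[ℝ] ℝ) :
    IsRegisterProgram fun v => Function.update (Function.update v d (relu (l v))) i
      (v i + c * relu (l v)) := by
  convert (isRegisterProgram_update_linear i (LinearMap.proj i + c • LinearMap.proj d)).comp
    ((isRegisterProgram_update_relu d).comp (isRegisterProgram_update_linear d l)) using 1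
  funext v
  simp [Function.comp, hid]

theorem computableFromRegisters_proj (i : ι) : ComputableFromRegisters fun v : ι → ℝ => v i := by
  classical
  refine ⟨.output (Matrix.of fun _ k => Sum.elim (fun j => if j = i then (1 : ℝ) else 0)
    (fun j => if j = i then -1 else 0) ((Fintype.equivFin (ι ⊕ ι)).symm k)), le_rfl, fun v => ?_⟩
  simp only [WeightStack.eval, Matrix.mulVec, dotProduct, signedEncoding, Matrix.of_apply]
  rw [Equiv.sum_comp (Fintype.equivFin (ι ⊕ ι)).symm (fun r =>
    Sum.elim (fun j => if j = i then (1 : ℝ) else 0) (fun j => if j = i then -1 else 0) r *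
      Sum.elim (fun i => relu (v i)) (fun i => relu (-v i)) r)]
  simp [Fintype.sum_sum_type, ← sub_eq_add_neg, relu_sub_relu_neg]

/-- The first layer of a network can load the input into some of the registers. -/
theorem ComputableFromRegisters.exists_weightStack [DecidableEq ι] {n : ℕ} {G : (ι → ℝ) → ℝ}
    (hG : ComputableFromRegisters G) (L : (Fin n → ℝ) →ₗ[ℝ] (ι → ℝ)) :
    ∃ S : WeightStack n 1, S.width ≤ max n (max (Fintype.card (ι ⊕ ι)) 1) ∧
      ∀ x, S.eval relu x 0 = G (L x) := by
  obtain ⟨S, hS, hG⟩ := hG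
  refine ⟨.hidden (Matrix.of fun k j => Sum.elim (fun i => LinearMap.toMatrix' L i j)
    (fun i => -LinearMap.toMatrix' L i j) ((Fintype.equivFin (ι ⊕ ι)).symm k)) S,
    max_le_max le_rfl hS, fun x => ?_⟩
  have hL : ∀ i, L x i = ∑ j, LinearMap.toMatrix' L i j * x j := fun i => by
    conv_lhs => rw [← Matrix.toLin'_toMatrix' L, Matrix.toLin'_apply]
    rfl
  rw [← hG, WeightStack.eval]
  congr 2
  funext k
  simp only [Matrix.mulVec, dotProduct, Matrix.of_apply, signedEncoding]
  rcases (Fintype.equivFin (ι ⊕ ι)).symm k with i | i <;> simp [hL]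

end Registers

/-! ### Lattice polynomials in linear forms as networks -/

/-- The restrictions of the linear forms to the unit sphere. -/
def linearFormsOnSphere (n : ℕ) : Set C(Metric.sphere (0 : Fin n → ℝ) 1, ℝ) :=
  Set.range fun l : Module.Dual ℝ (Fin n → ℝ) =>
    ⟨fun x => l x, l.continuous_of_finiteDimensional.comp continuous_subtype_val⟩

section Programs

variable {n : ℕ}

/-- Evaluation of a linear form at the input registers. -/
def inputForm (l : Module.Dual ℝ (Fin n → ℝ)) : (Fin n ⊕ Fin 3 → ℝ) →ₗ[ℝ] ℝ :=
  l ∘ₗ LinearMap.funLeft ℝ ℝ Sum.inl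

theorem inputForm_apply (l : Module.Dual ℝ (Fin n → ℝ)) {v : Fin n ⊕ Fin 3 → ℝ} {x : Fin n → ℝ}
    (hv : ∀ j, v (.inl j) = x j) : inputForm l v = l x := by
  have : (LinearMap.funLeft ℝ ℝ Sum.inl) v = x := funext hv
  rw [inputForm, LinearMap.comp_apply, this]

/-- Some program leaves the input registers and the first work register alone and
stores `h x` in the second one. -/
theorem exists_program_of_mem_infClosure {h : C(Metric.sphere (0 : Fin n → ℝ) 1, ℝ)}
    (hh : h ∈ infClosure (linearFormsOnSphere n)) :
    ∃ T : (Fin n ⊕ Fin 3 → ℝ) → (Fin n ⊕ Fin 3 → ℝ), IsRegisterProgram T ∧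
      (∀ v j, T v (.inl j) = v (.inl j)) ∧ (∀ v, T v (.inr 0) = v (.inr 0)) ∧
      ∀ v (x : Metric.sphere (0 : Fin n → ℝ) 1), (∀ j, v (.inl j) = x.1 j) →
        T v (.inr 1) = h x := by
  obtain ⟨t, ht, hts, rfl⟩ := hh
  induction ht using Finset.Nonempty.cons_induction with
  | singleton a =>
    obtain ⟨l, rfl⟩ : a ∈ linearFormsOnSphere n := hts (by simp)
    refine ⟨_, isRegisterProgram_update_linear (.inr 1) (inputForm l), by simp, by simp,
      fun v x hx => ?_⟩
    simp [inputForm_apply l hx]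
  | cons a s ha hs ih =>
    obtain ⟨T, hT, hT1, hT2, hT3⟩ := ih fun b hb => hts (by
      simp only [Finset.coe_cons, Set.mem_insert_iff]; exact Or.inr hb)
    obtain ⟨l, hl⟩ : a ∈ linearFormsOnSphere n := hts (by simp)
    refine ⟨_, (isRegisterProgram_add_relu (i := .inr 1) (d := .inr 2) (by simp) (-1)
      (LinearMap.proj (.inr 1) - inputForm l)).comp hT, by simp [hT1], by simp [hT2],
      fun v x hx => ?_⟩
    have hTx : ∀ j, T v (.inl j) = x.1 j := fun j => (hT1 v j).trans (hx j)
    simp only [Function.comp, Function.update_self, LinearMap.sub_apply, LinearMap.proj_apply,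
      inputForm_apply l hTx, hT3 v x hx, neg_one_mul, ← sub_eq_add_neg]
    rw [← min_eq_sub_relu, Finset.inf'_cons hs, ContinuousMap.inf_apply, min_comm]
    subst hl
    rfl

/-- Some program leaves the input registers alone and stores `h x` in the first work register. -/
theorem exists_program_of_mem_latticeClosure {h : C(Metric.sphere (0 : Fin n → ℝ) 1, ℝ)}
    (hh : h ∈ latticeClosure (linearFormsOnSphere n)) :
    ∃ T : (Fin n ⊕ Fin 3 → ℝ) → (Fin n ⊕ Fin 3 → ℝ), IsRegisterProgram T ∧
      (∀ v j, T v (.inl j) = v (.inl j)) ∧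
      ∀ v (x : Metric.sphere (0 : Fin n → ℝ) 1), (∀ j, v (.inl j) = x.1 j) →
        T v (.inr 0) = h x := by
  -- Distributivity puts every lattice polynomial in the form of a maximum of minima, so two nested
  -- accumulators suffice.
  let D : DistribLattice C(Metric.sphere (0 : Fin n → ℝ) 1, ℝ) :=
    { (inferInstance : Lattice C(Metric.sphere (0 : Fin n → ℝ) 1, ℝ)) with
      le_sup_inf := fun f g k x => le_sup_inf (x := f x) (y := g x) (z := k x) }
  replace hh : h ∈ supClosure (infClosure (linearFormsOnSphere n)) :=
    (@supClosure_infClosure _ D (linearFormsOnSphere n)).symm ▸ hh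
  obtain ⟨t, ht, hts, rfl⟩ := hh
  induction ht using Finset.Nonempty.cons_induction with
  | singleton a =>
    obtain ⟨T, hT, hT1, -, hT3⟩ := exists_program_of_mem_infClosure (h := a) (hts (by simp))
    refine ⟨_, (isRegisterProgram_update_linear (.inr 0) (LinearMap.proj (.inr 1))).comp hT,
      by simp [hT1], fun v x hx => ?_⟩
    simp [hT3 v x hx]
  | cons a s ha hs ih =>
    obtain ⟨T, hT, hT1, hT3⟩ := ih fun b hb => hts (by
      simp only [Finset.coe_cons, Set.mem_insert_iff]; exact Or.inr hb)
    -- `U` computes the next minimum in `.inr 1` and preserves the running maximum in `.inr 0`.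
    obtain ⟨U, hU, hU1, hU2, hU3⟩ := exists_program_of_mem_infClosure (h := a) (hts (by simp))
    refine ⟨_, (isRegisterProgram_add_relu (i := .inr 0) (d := .inr 2) (by simp) 1
      (LinearMap.proj (.inr 1) - LinearMap.proj (.inr 0))).comp (hU.comp hT), by simp [hT1, hU1],
      fun v x hx => ?_⟩
    have hTx : ∀ j, T v (.inl j) = x.1 j := fun j => (hT1 v j).trans (hx j)
    simp only [Function.comp, Function.update_self, LinearMap.sub_apply, LinearMap.proj_apply,
      hU3 _ x hTx, hU2, hT3 v x hx, one_mul]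
    rw [← max_eq_add_relu, Finset.sup'_cons hs, ContinuousMap.sup_apply, max_comm]
    rfl

/-- The lattice polynomials in linear forms are networks of width at most `2 * (n + 4)`. -/
theorem exists_weightStack_of_mem_latticeClosure {h : C(Metric.sphere (0 : Fin n → ℝ) 1, ℝ)}
    (hh : h ∈ latticeClosure (linearFormsOnSphere n)) :
    ∃ S : WeightStack n 1, S.width ≤ 2 * (n + 4) ∧
      ∀ x : Metric.sphere (0 : Fin n → ℝ) 1, S.eval relu x.1 0 = h x := by
  obtain ⟨T, hT, -, hT3⟩ := exists_program_of_mem_latticeClosure hh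
  obtain ⟨S, hS, hSe⟩ := (hT _ (computableFromRegisters_proj (.inr 0))).exists_weightStack
    (LinearMap.pi (Sum.elim (fun j => LinearMap.proj j) fun _ => (0 : (Fin n → ℝ) →ₗ[ℝ] ℝ)))
  refine ⟨S, hS.trans ?_, fun x => ?_⟩
  · simp only [Fintype.card_sum, Fintype.card_fin]
    omega
  · rw [hSe]
    exact hT3 _ x fun j => by simp

end Programs

/-! ### Density on the sphere -/

theorem Module.Dual.exists_apply_eq_apply_eq {K V : Type*} [Field K] [AddCommGroup V] [Module K V]
    {x y : V} (h : LinearIndependent K ![x, y]) (a b : K) :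
    ∃ l : Module.Dual K V, l x = a ∧ l y = b := by
  obtain ⟨g, hg⟩ := LinearMap.exists_leftInverse_of_injective _
    (LinearMap.ker_eq_bot.2 h.fintypeLinearCombination_injective)
  refine ⟨(Fintype.linearCombination K ![a, b]) ∘ₗ g, ?_, ?_⟩
  · have := LinearMap.congr_fun hg (Pi.single 0 1)
    simp [Fintype.linearCombination_apply] at this
    simp [this, Fintype.linearCombination_apply]
  · have := LinearMap.congr_fun hg (Pi.single 1 1)
    simp [Fintype.linearCombination_apply] at this
    simp [this, Fintype.linearCombination_apply]

/-- One linear form interpolates at independent or equal points. The only other dependent pairs on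
the sphere are antipodal, where linear forms are odd and a maximum or minimum of two is needed. -/
theorem separatesPointsStrongly_latticeClosure_linearFormsOnSphere (n : ℕ) :
    (latticeClosure (linearFormsOnSphere n) : Set _).SeparatesPointsStrongly := by
  intro v x y
  have mem : ∀ l : Module.Dual ℝ (Fin n → ℝ), (⟨fun x => l x,
      l.continuous_of_finiteDimensional.comp continuous_subtype_val⟩ :
      C(Metric.sphere (0 : Fin n → ℝ) 1, ℝ)) ∈ latticeClosure (linearFormsOnSphere n) :=
    fun l => subset_latticeClosure ⟨l, rfl⟩
  have hlat := isSublattice_latticeClosure (s := linearFormsOnSphere n)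
  have hx : ‖x.1‖ = 1 := by simp
  have hy : ‖y.1‖ = 1 := by simp
  have hx0 : x.1 ≠ 0 := fun h => by simp [h] at hx
  obtain ⟨l, hl⟩ : ∃ l : Module.Dual ℝ (Fin n → ℝ), l x.1 = 1 := by
    obtain ⟨i, hi⟩ := Function.ne_iff.1 hx0
    exact ⟨(x.1 i)⁻¹ • LinearMap.proj i, by simpa using inv_mul_cancel₀ hi⟩
  by_cases hxy : LinearIndependent ℝ ![x.1, y.1]
  · obtain ⟨k, hk⟩ := Module.Dual.exists_apply_eq_apply_eq hxy (v x) (v y)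
    exact ⟨_, mem k, hk⟩
  · rw [LinearIndependent.pair_iff' hx0] at hxy
    push Not at hxy
    obtain ⟨c, hc⟩ := hxy
    have hc1 : |c| = 1 := by
      rw [← hc, norm_smul, hx, mul_one] at hy
      exact hy
    rcases eq_or_eq_neg_of_abs_eq hc1 with rfl | rfl
    · obtain rfl : x = y := Subtype.ext (by simpa using hc)
      exact ⟨_, mem (v x • l), by simp [hl], by simp [hl]⟩
    · have hly : l y.1 = -1 := by rw [← hc, map_smul, hl]; simp
      -- At `(x, y)` the two forms take the values `(v x, -v x)` and `(-v y, v y)`; the sign of `v x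
      -- + v y` decides between maximum and minimum.
      rcases le_total (-v y) (v x) with h | h
      · refine ⟨_, hlat.supClosed (mem (v x • l)) (mem (-v y • l)), ?_, ?_⟩
        · simpa [hl] using h
        · simp [hly]; linarith
      · refine ⟨_, hlat.infClosed (mem (v x • l)) (mem (-v y • l)), ?_, ?_⟩
        · simpa [hl] using h
        · simp [hly]; linarith

/-- Every continuous function on the unit sphere is a uniform limit of bias-free ReLU networks of
width at most `2 * (n + 4)`. -/
theorem exists_weightStack_forall_sphere_abs_sub_lt {n : ℕ}
    (φ : C(Metric.sphere (0 : Fin n → ℝ) 1, ℝ)) {δ : ℝ} (hδ : 0 < δ) :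
    ∃ S : WeightStack n 1, S.width ≤ 2 * (n + 4) ∧
      ∀ x : Metric.sphere (0 : Fin n → ℝ) 1, |φ x - S.eval relu x.1 0| < δ := by
  have hlat := isSublattice_latticeClosure (s := linearFormsOnSphere n)
  have hdense := ContinuousMap.sublattice_closure_eq_top
    (latticeClosure (linearFormsOnSphere n)) ⟨_, subset_latticeClosure ⟨0, rfl⟩⟩
    (fun f hf g hg => hlat.infClosed hf hg) (fun f hf g hg => hlat.supClosed hf hg)
    (separatesPointsStrongly_latticeClosure_linearFormsOnSphere n)
  obtain ⟨h, hh, hd⟩ := Metric.mem_closure_iff.1 (hdense ▸ Set.mem_univ φ :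
    φ ∈ closure (latticeClosure (linearFormsOnSphere n))) δ hδ
  obtain ⟨S, hS, hSe⟩ := exists_weightStack_of_mem_latticeClosure hh
  refine ⟨S, hS, fun x => ?_⟩
  rw [hSe, ← Real.dist_eq]
  exact (ContinuousMap.dist_apply_le_dist x).trans_lt hd

/-! ### Homogeneous functions by averaging along rays -/

section RadialAverage

variable {E : Type*} [NormedAddCommGroup E] [NormedSpace ℝ E] [FiniteDimensional ℝ E]
  [MeasurableSpace E] [BorelSpace E] (μ : Measure E) [μ.IsAddHaarMeasure]

theorem measurableSet_preimage_smul {Z : Set E} (hZ : MeasurableSet Z) :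
    MeasurableSet {p : E × ℝ | p.2 • p.1 ∈ Z} :=
  (measurable_snd.smul measurable_fst) hZ

/-- A null set is radially null along almost every ray. -/
theorem ae_ae_smul_notMem_of_measure_eq_zero {Z : Set E} (hZ : MeasurableSet Z) (h : μ Z = 0) :
    ∀ᵐ x ∂μ, ∀ᵐ t ∂(volume.restrict (Set.Ioi (0 : ℝ))), t • x ∉ Z := by
  have h0 : (μ.prod (volume.restrict (Set.Ioi (0 : ℝ)))) {p | p.2 • p.1 ∈ Z} = 0 := by
    rw [← Measure.prod_swap, Measure.map_apply measurable_swap (measurableSet_preimage_smul hZ),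
      Measure.measure_prod_null (measurable_swap (measurableSet_preimage_smul hZ))]
    filter_upwards [ae_restrict_mem measurableSet_Ioi] with t (ht : 0 < t)
    change μ ((fun x => t • x) ⁻¹' Z) = 0
    rw [Measure.addHaar_preimage_smul μ ht.ne', h, mul_zero]
  filter_upwards [Measure.measure_ae_null_of_prod_null h0] with x hx
  rw [ae_iff]
  simpa using hx

/-- A set that is radially null along every ray is null. -/
theorem measure_eq_zero_of_ae_smul_notMem {Z : Set E} (hZ : MeasurableSet Z)
    (h : ∀ x, ∀ᵐ t ∂(volume.restrict (Set.Ioi (0 : ℝ))), t • x ∉ Z) : μ Z = 0 := by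
  have h0 : ((volume.restrict (Set.Ioi (0 : ℝ))).prod μ) {p | p.1 • p.2 ∈ Z} = 0 := by
    change ((volume.restrict (Set.Ioi (0 : ℝ))).prod μ)
      (Prod.swap ⁻¹' {p : E × ℝ | p.2 • p.1 ∈ Z}) = 0
    rw [← Measure.map_apply measurable_swap (measurableSet_preimage_smul hZ), Measure.prod_swap,
      Measure.measure_prod_null (measurableSet_preimage_smul hZ)]
    refine Filter.Eventually.of_forall fun x => ?_
    have := h x
    rw [ae_iff] at this
    simpa using this
  have h1 := Measure.measure_ae_null_of_prod_null h0
  have h2 : (volume.restrict (Set.Ioi (0 : ℝ))) ≠ 0 := by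
    simp [Measure.restrict_eq_zero]
  have : (ae (volume.restrict (Set.Ioi (0 : ℝ)))).NeBot := ae_neBot.2 h2
  -- One positive `t` with null preimage is enough, as dilation only rescales Haar measure.
  obtain ⟨t, ht1, ht⟩ := (h1.and (ae_restrict_mem measurableSet_Ioi)).exists
  have ht1 : μ ((fun x => t • x) ⁻¹' Z) = 0 := ht1
  rw [Measure.addHaar_preimage_smul μ (ne_of_gt ht)] at ht1
  refine (mul_eq_zero.1 ht1).resolve_left ?_
  have : t ≠ 0 := ne_of_gt ht
  simp [this]

/-- Almost every ray through a point of `X` meets `X` in a set of positive length. -/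
theorem ae_mem_imp_frequently_smul_mem {X : Set E} (hX : MeasurableSet X) :
    ∀ᵐ x ∂μ, x ∈ X → ¬ ∀ᵐ t ∂(volume.restrict (Set.Ioi (0 : ℝ))), t • x ∉ X := by
  set Z := {x ∈ X | ∀ᵐ t ∂(volume.restrict (Set.Ioi (0 : ℝ))), t • x ∉ X}
  have hZm : MeasurableSet Z := by
    have := measurable_measure_prodMk_left (ν := volume.restrict (Set.Ioi (0 : ℝ)))
      (measurableSet_preimage_smul hX)
    convert hX.inter (this (measurableSet_singleton 0)) using 1
    refine Set.ext fun x => and_congr_right fun _ => ?_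
    rw [ae_iff]
    simp
  have hZ0 : μ Z = 0 := by
    -- If a ray meets `Z` at all, rescaling the parameter shows that it meets `X` in length zero.
    refine measure_eq_zero_of_ae_smul_notMem μ hZm fun x => ?_
    by_cases hx : ∃ s : ℝ, 0 < s ∧ s • x ∈ Z
    · obtain ⟨s, hs, hsx⟩ := hx
      have hsx' : volume ({t : ℝ | t • s • x ∈ X} ∩ Set.Ioi 0) = 0 := by
        have := hsx.2
        rw [ae_iff, Measure.restrict_apply' measurableSet_Ioi] at this
        simpa using this
      rw [ae_iff, Measure.restrict_apply' measurableSet_Ioi]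
      refine measure_mono_null (t := (fun t => s⁻¹ * t) ⁻¹' ({t : ℝ | t • s • x ∈ X} ∩ Set.Ioi 0))
        ?_ ?_
      · rintro t ⟨ht, ht0 : 0 < t⟩
        simp only [not_not, Set.mem_ofPred_eq] at ht
        refine ⟨?_, mul_pos (inv_pos.2 hs) ht0⟩
        have : (s⁻¹ * t) • s • x = t • x := by
          rw [smul_smul]; congr 1; field_simp
        simpa only [Set.mem_ofPred_eq, this] using ht.1
      · rw [Real.volume_preimage_mul_left (inv_ne_zero hs.ne'), hsx', mul_zero]
    · filter_upwards [ae_restrict_mem measurableSet_Ioi] with t ht htx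
      exact hx ⟨t, ht, htx⟩
  filter_upwards [measure_eq_zero_iff_ae_notMem.1 hZ0] with x hx hxX hxt
  exact hx ⟨hxX, hxt⟩

/-- A positive-homogeneous function on a bounded measurable set that is almost everywhere measurable
agrees almost everywhere with a measurable positive-homogeneous function on the whole space. -/
theorem PosHomogeneousOn.exists_measurable_ae_eq {X : Set E} (hX : MeasurableSet X)
    (hXb : Bornology.IsBounded X) {f : E → ℝ} (hf : PosHomogeneousOn f X)
    (hfm : AEStronglyMeasurable f (μ.restrict X)) :
    ∃ G : E → ℝ, Measurable G ∧ PosHomogeneousOn G Set.univ ∧ G =ᵐ[μ.restrict X] f := by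
  set ν : Measure ℝ := volume.restrict (Set.Ioi (0 : ℝ))
  set f₀ := hfm.mk f
  have hf₀ : Measurable f₀ := hfm.stronglyMeasurable_mk.measurable
  set k := X.indicator f₀
  have hk : Measurable k := hf₀.indicator hX
  -- Since `f (t • x) = t * f x`, one expects `N = f * D` on `X`. `N` has degree `-1` and `D` degree
  -- `-2`, so `N / D` has degree `1`.
  set N : E → ℝ := fun x => ∫ t in Set.Ioi (0 : ℝ), k (t • x)
  set D : E → ℝ := fun x => ∫ t in Set.Ioi (0 : ℝ), X.indicator (fun _ => t) (t • x)
  have hsm : Measurable fun p : E × ℝ => p.2 • p.1 := measurable_snd.smul measurable_fst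
  have hN : Measurable N :=
    (StronglyMeasurable.integral_prod_right' (ν := ν) (f := fun p : E × ℝ => k (p.2 • p.1))
      (hk.comp hsm).stronglyMeasurable).measurable
  have hD : Measurable D := by
    have : Measurable fun p : E × ℝ => X.indicator (fun _ => p.2) (p.2 • p.1) := by
      convert measurable_snd.indicator (measurableSet_preimage_smul hX) using 1
      funext p
      classical simp [Set.indicator_apply]
    exact (this.stronglyMeasurable.integral_prod_right' (ν := ν)).measurable
  have hNc : ∀ c : ℝ, 0 < c → ∀ x, N (c • x) = c⁻¹ * N x := fun c hc x => by
    have := integral_comp_mul_left_Ioi (fun t => k (t • x)) 0 hc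
    simp only [mul_zero, smul_eq_mul] at this
    simp only [N, smul_smul, ← this, mul_comm c]
  have hDc : ∀ c : ℝ, 0 < c → ∀ x, D (c • x) = c⁻¹ * (c⁻¹ * D x) := fun c hc x => by
    have := integral_comp_mul_left_Ioi (fun t => X.indicator (fun _ => t) (t • x)) 0 hc
    simp only [mul_zero, smul_eq_mul] at this
    simp only [D]
    rw [← this, ← integral_const_mul]
    refine integral_congr_ae (Filter.Eventually.of_forall fun t => ?_)
    simp only [smul_smul, mul_comm t c]
    by_cases h : (c * t) • x ∈ X
    · simp only [Set.indicator_of_mem h]; field_simp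
    · simp only [Set.indicator_of_notMem h, mul_zero]
  refine ⟨fun x => N x / D x, hN.div hD, fun c hc x _ _ => ?_, ?_⟩
  · simp only [hNc c hc, hDc c hc]
    rw [mul_div_mul_left _ _ (inv_ne_zero hc.ne'), div_mul_eq_div_div_swap, div_inv_eq_mul,
      mul_comm]
  have hfae := (ae_restrict_iff' hX).1 hfm.ae_eq_mk
  set M := toMeasurable μ {x | ¬ (x ∈ X → f x = f₀ x)}
  have hM0 : μ M = 0 := by rw [measure_toMeasurable]; exact ae_iff.1 hfae
  rw [Filter.EventuallyEq, ae_restrict_iff' hX]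
  filter_upwards [ae_ae_smul_notMem_of_measure_eq_zero μ (measurableSet_toMeasurable _ _) hM0,
    ae_mem_imp_frequently_smul_mem μ hX] with x hxM hxX hx
  by_cases hx0 : x = 0
  · subst hx0
    have h1 : f 0 = 0 := by
      have := hf 2 two_pos 0 hx (by simpa using hx)
      rw [smul_zero] at this; linarith
    rw [h1]
    -- The integrand is constant on a half-line of infinite measure, so the integral takes its
    -- default value `0`.
    simp [N, Measure.real]
  have hND : N x = f x * D x := by
    simp only [N, D]
    rw [← integral_const_mul]
    refine integral_congr_ae ?_
    filter_upwards [hxM, ae_restrict_mem measurableSet_Ioi] with t ht ht0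
    by_cases h : t • x ∈ X
    · have h2 : f (t • x) = f₀ (t • x) := by
        by_contra h3
        exact ht (subset_toMeasurable _ _ fun h4 => h3 (h4 h))
      simp only [k, Set.indicator_of_mem h]
      rw [← h2, hf t ht0 x hx h, mul_comm]
    · simp only [k, Set.indicator_of_notMem h, mul_zero]
  obtain ⟨R, hR⟩ := hXb.exists_norm_le
  have hbd : ∀ t : ℝ, 0 < t → t • x ∈ X → t ≤ R / ‖x‖ := fun t ht h => by
    rw [le_div_iff₀ (norm_pos_iff.2 hx0)]
    simpa [norm_smul, abs_of_pos ht] using hR _ h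
  have hmeas : Measurable fun t : ℝ => t • x := measurable_id.smul_const x
  have hDm : Measurable fun t : ℝ => X.indicator (fun _ => t) (t • x) := by
    convert measurable_id.indicator (hmeas hX) using 1
    funext t
    classical simp [Set.indicator_apply]
  have hpos : 0 < D x := by
    have hnn : ∀ᵐ t ∂ν, 0 ≤ X.indicator (fun _ => t) (t • x) := by
      filter_upwards [ae_restrict_mem measurableSet_Ioi] with t ht
      exact Set.indicator_nonneg (fun _ _ => le_of_lt ht) _
    refine lt_of_le_of_ne (integral_nonneg_of_ae hnn) fun h => ?_
    -- Boundedness of `X` enters here: without integrability, `D x = 0` could be a mere default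
    -- value.
    have hint : Integrable (fun t : ℝ => X.indicator (fun _ => t) (t • x)) ν := by
      refine Integrable.mono' (g := (Set.Ioc 0 (R / ‖x‖)).indicator fun _ => R / ‖x‖) ?_
        hDm.aestronglyMeasurable ?_
      · refine (integrable_indicator_iff measurableSet_Ioc).2 (integrableOn_const ?_)
        exact ((Measure.restrict_apply_le _ _).trans_lt (by simp)).ne
      · filter_upwards [ae_restrict_mem measurableSet_Ioi] with t ht
        by_cases h : t • x ∈ X
        · rw [Set.indicator_of_mem h, Set.indicator_of_mem (show t ∈ Set.Ioc 0 (R / ‖x‖) from ⟨ht, hbd t ht h⟩), Real.norm_eq_abs,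
            abs_of_pos ht]
          exact hbd t ht h
        · rw [Set.indicator_of_notMem h, norm_zero]
          refine Set.indicator_nonneg (fun s hs => hs.1.le.trans hs.2) _
    refine hxX hx ?_
    filter_upwards [(integral_eq_zero_iff_of_nonneg_ae hnn hint).1 h.symm,
      ae_restrict_mem measurableSet_Ioi] with t ht ht0 htX
    rw [Set.indicator_of_mem htX] at ht
    exact (ne_of_gt ht0) ht
  rw [hND, mul_div_cancel_right₀ _ hpos.ne']

end RadialAverage

/-! ### Approximation in mean and conclusion -/

/-- A measurable positive-homogeneous function that is integrable on a bounded set is approximated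
there in mean by the homogeneous extensions of continuous functions on the sphere. -/
theorem PosHomogeneousOn.exists_boundedContinuous_integral_sub_le {E : Type*}
    [NormedAddCommGroup E] [NormedSpace ℝ E] [MeasurableSpace E] [BorelSpace E]
    {μ : Measure E} (hμ : Integrable (fun x => ‖x‖) μ)
    {G : E → ℝ} (hGm : Measurable G) (hG : PosHomogeneousOn G Set.univ) (hGi : Integrable G μ)
    {ε : ℝ} (hε : 0 < ε) :
    ∃ φ : BoundedContinuousFunction E ℝ, ∫ x, |G x - ‖x‖ * φ (‖x‖⁻¹ • x)| ∂μ ≤ ε := by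
  set π : E → E := fun x => ‖x‖⁻¹ • x
  have hπ : Measurable π := measurable_norm.inv.smul measurable_id
  have hnn : Measurable fun x : E => ‖x‖₊ := measurable_nnnorm
  have hG0 : G 0 = 0 := by
    have := hG 2 two_pos 0 trivial trivial
    rw [smul_zero] at this; linarith
  have hGπ : ∀ x, ‖x‖ * G (π x) = G x := fun x => by
    by_cases hx : x = 0
    · simp [hx, hG0]
    · have hx' := norm_pos_iff.2 hx
      rw [hG _ (inv_pos.2 hx') x trivial trivial, mul_inv_cancel_left₀ hx'.ne']
  -- With weight `‖x‖`, the L¹ distance of `G` and `φ` for `ρ.map π` is exactly the distance to be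
  -- bounded. The origin has weight zero.
  set ρ : Measure E := μ.withDensity fun x => (‖x‖₊ : ENNReal)
  have hρ : IsFiniteMeasure ρ := by
    refine isFiniteMeasure_withDensity ?_
    have := hμ.2
    simpa [HasFiniteIntegral, enorm_eq_nnnorm] using this.ne
  have hGν : Integrable G (ρ.map π) := by
    rw [integrable_map_measure hGm.aestronglyMeasurable hπ.aemeasurable,
      integrable_withDensity_iff_integrable_smul hnn]
    simpa only [NNReal.smul_def, coe_nnnorm, smul_eq_mul, Function.comp, hGπ] using hGi
  have : IsFiniteMeasure (ρ.map π) := Measure.isFiniteMeasure_map _ _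
  obtain ⟨φ, hφ, -⟩ := hGν.exists_boundedContinuous_integral_sub_le hε
  refine ⟨φ, le_of_eq_of_le ?_ hφ⟩
  have hm : Measurable fun x => ‖G x - φ x‖ := (hGm.sub φ.continuous.measurable).norm
  rw [integral_map hπ.aemeasurable hm.aestronglyMeasurable,
    integral_withDensity_eq_integral_smul hnn]
  refine integral_congr_ae (Filter.Eventually.of_forall fun x => ?_)
  simp only [NNReal.smul_def, coe_nnnorm, smul_eq_mul]
  conv_lhs => rw [← hGπ x, ← mul_sub, abs_mul, abs_norm]
  rfl

theorem theorem2 (n : ℕ) (X : Set (Fin n → ℝ)) (hX : IsCompact X)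
    (f : (Fin n → ℝ) → ℝ) (hf : PosHomogeneousOn f X) (hint : IntegrableOn f X volume)
    (ε : ℝ) (hε : 0 < ε) :
    ∃ A : HomoMLP n 1, A.act = relu ∧ A.width ≤ 2 * (n + 4) ∧
      IntegrableOn (fun x => |f x - A.toFun x|) X volume ∧
      ∫ x in X, |f x - A.toFun x| < ε := by
  have hnorm : Integrable (fun x : Fin n → ℝ => ‖x‖) (volume.restrict X) :=
    continuous_norm.continuousOn.integrableOn_compact hX
  obtain ⟨G, hGm, hG, hGf⟩ := hf.exists_measurable_ae_eq volume hX.measurableSet hX.isBounded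
    hint.aestronglyMeasurable
  obtain ⟨φ, hφ⟩ := hG.exists_boundedContinuous_integral_sub_le hnorm hGm
    (hint.congr hGf.symm) (half_pos hε)
  set C := ∫ x in X, ‖x‖
  have hC : 0 ≤ C := integral_nonneg fun x => norm_nonneg x
  -- `C + 1` avoids dividing by zero and makes the final inequality strict.
  have hδ : 0 < ε / 2 / (C + 1) := by positivity
  obtain ⟨S, hS, hSφ⟩ := exists_weightStack_forall_sphere_abs_sub_lt
    (φ.toContinuousMap.restrict (Metric.sphere (0 : Fin n → ℝ) 1)) hδ
  set F : (Fin n → ℝ) → ℝ := fun x => S.eval relu x 0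
  have hFc : Continuous F := (continuous_apply 0).comp S.continuous_eval_relu
  have hFh : ∀ (c : ℝ), 0 ≤ c → ∀ x, F (c • x) = c * F x := fun c hc x => by
    simp only [F, S.eval_relu_smul hc, Pi.smul_apply, smul_eq_mul]
  have hFφ : ∀ x, |‖x‖ * φ (‖x‖⁻¹ • x) - F x| ≤ ε / 2 / (C + 1) * ‖x‖ := fun x => by
    by_cases hx : x = 0
    · have : F 0 = 0 := by simpa using hFh 0 le_rfl 0
      simp [hx, this]
    · have hx' := norm_pos_iff.2 hx
      have h1 : F x = ‖x‖ * F (‖x‖⁻¹ • x) := by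
        rw [hFh _ (inv_pos.2 hx').le, mul_inv_cancel_left₀ hx'.ne']
      have h2 := hSφ ⟨‖x‖⁻¹ • x, by simp [norm_smul, hx'.ne']⟩
      rw [h1, ← mul_sub, abs_mul, abs_norm, mul_comm]
      exact mul_le_mul_of_nonneg_right h2.le hx'.le
  have hFi : Integrable F (volume.restrict X) := hFc.continuousOn.integrableOn_compact hX
  refine ⟨⟨relu, fun l hl x _ _ => relu_mul_of_nonneg hl.le x, S⟩, rfl, hS, ?_, ?_⟩
  · exact (hint.sub hFi).abs
  change ∫ x in X, |f x - F x| < ε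
  have hφm : Measurable fun x : Fin n → ℝ => ‖x‖ * φ (‖x‖⁻¹ • x) :=
    measurable_norm.mul (φ.continuous.measurable.comp (measurable_norm.inv.smul measurable_id))
  have hφi : Integrable (fun x : Fin n → ℝ => ‖x‖ * φ (‖x‖⁻¹ • x)) (volume.restrict X) := by
    refine (hnorm.mul_const ‖φ‖).mono' hφm.aestronglyMeasurable (.of_forall fun x => ?_)
    rw [norm_mul, norm_norm]
    exact mul_le_mul_of_nonneg_left (φ.norm_coe_le_norm _) (norm_nonneg x)
  have hGφ : Integrable (fun x => |G x - ‖x‖ * φ (‖x‖⁻¹ • x)|) (volume.restrict X) :=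
    ((hint.congr hGf.symm).sub hφi).abs
  calc ∫ x in X, |f x - F x|
      ≤ ∫ x in X, (|G x - ‖x‖ * φ (‖x‖⁻¹ • x)| + ε / 2 / (C + 1) * ‖x‖) := by
        refine integral_mono_ae (hint.sub hFi).abs
          (hGφ.add (hnorm.const_mul _)) ?_
        filter_upwards [hGf] with x hx
        rw [← hx]
        exact (abs_sub_le _ _ _).trans (add_le_add le_rfl (hFφ x))
    _ = (∫ x in X, |G x - ‖x‖ * φ (‖x‖⁻¹ • x)|) + ε / 2 / (C + 1) * C := by
        rw [integral_add hGφ (hnorm.const_mul _),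
          integral_const_mul]
    _ < ε / 2 + ε / 2 := by
        refine add_lt_add_of_le_of_lt hφ ?_
        rw [div_mul_eq_mul_div, div_lt_iff₀ (by positivity)]
        nlinarith
    _ = ε := add_halves ε
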